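/- Let $d$ be a non-negative integer, and let $\mathcal H=\bigoplus_{n=0}^d\bigwedge^n(\mathbb C^d)$ be the Fock space of $d$ fermionic modes, with creation and annihilation operators $f_j^\dagger, f_j$ and Majorana operators $m_{2j-1}=f_j+f_j^\dagger$, $m_{2j}=-i(f_j-f_j^\dagger)$ for $j=1,\dots,d$. For $O\in \mathrm{SO}(2d)$ write $$\Pi_{\mathrm{act}}(O)=\exp\Big(\tfrac14\sum_{i,j=1}^{2d}[\log O]_{ij}\,m_i m_j\Big),$$ where $\log O$ is any real antisymmetric matrix $A$ with $e^A=O$ (the choice of $A$ affects $\Pi_{\mathrm{act}}(O)$ at most by a sign). For an operator $V$ on $\mathcal H$ let $\Phi_V$ be the map $\rho\mapsto V\rho V^\dagger$. For a linear map $\Phi$ on the operators on $\mathcal H$ let $$\|\Phi\|_\Diamond=\sup_{k}\ \sup_{\|X\|_1\le 1}\|(\Phi\otimes \mathrm{id}_{k})(X)\|_1$$ be its diamond norm, where $X$ ranges over the operators on $\mathcal H\otimes\mathbb C^k$ and $\|\cdot\|_1$ is the trace norm. Let $O,O'\in \mathrm{SO}(2d)$, and let $V=\Pi_{\mathrm{act}}(O)$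 and $V'=\Pi_{\mathrm{act}}(O')$, for any choices of the logarithms. Then $$\|\Phi_V-\Phi_{V'}\|_\Diamond\le 2d\,\|O-O'\|,$$ where $\|\cdot\|$ on the right is the operator norm with respect to the Euclidean norm on $\mathbb R^{2d}$. -/

import Mathlib

noncomputable section

namespace FLO

open Matrix

/-- Operators on the `d`-mode fermionic Fock space `⨁ₙ ⋀ⁿ(ℂᵈ)`, written as matrices in the
orthonormal Fock basis `|X⟩ = f†_{a₁} ⋯ f†_{aₙ} |0⟩`, where `X = {a₁ < ⋯ < aₙ}` runs over the
subsets of the set of modes. -/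
abbrev FockOp (d : ℕ) : Type := Matrix (Finset (Fin d)) (Finset (Fin d)) ℂ

/-- The creation operator `f†_j`: it sends `|Y⟩` to `(-1)^{#{k ∈ Y : k < j}} |Y ∪ {j}⟩` if
`j ∉ Y`, and to `0` if `j ∈ Y`. -/
def creation {d : ℕ} (j : Fin d) : FockOp d :=
  Matrix.of fun X Y =>
    if j ∉ Y ∧ X = insert j Y then (-1 : ℂ) ^ (Y.filter (fun k => k < j)).card else 0

/-- The annihilation operator `f_j`, the adjoint of `f†_j`. -/
def annihilation {d : ℕ} (j : Fin d) : FockOp d := (creation j)ᴴ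

/-- The Majorana operators. With modes and Majorana indices counted from `0`, the mode `j` gives
`m_{2j} = f_j + f†_j` and `m_{2j+1} = -i (f_j - f†_j)`. -/
def majorana {d : ℕ} (k : Fin (2 * d)) : FockOp d :=
  let j : Fin d := ⟨k.val / 2, by have := k.isLt; omega⟩
  if k.val % 2 = 0 then annihilation j + creation j
  else (-Complex.I) • (annihilation j - creation j)

/-- The Gaussian operator `exp (1/4 ∑_{i,j} A_{ij} m_i m_j)`. -/
def gaussianOp {d : ℕ} (A : Matrix (Fin (2 * d)) (Fin (2 * d)) ℝ) : FockOp d :=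
  NormedSpace.exp ((1 / 4 : ℂ) • ∑ i, ∑ j, (A i j : ℂ) • (majorana i * majorana j))

/-- `V = Π_act(O)`, that is `V = exp (1/4 ∑_{i,j} [log O]_{ij} m_i m_j)`, where `log O` may be
any real antisymmetric logarithm of `O`. (The map `Π_act` is a projective representation:
another logarithm of `O` may change the sign of `V`.) -/
def IsActiveFLO {d : ℕ} (O : Matrix.specialOrthogonalGroup (Fin (2 * d)) ℝ) (V : FockOp d) :
    Prop :=
  ∃ A : Matrix (Fin (2 * d)) (Fin (2 * d)) ℝ,
    Aᵀ = -A ∧ NormedSpace.exp A = (O : Matrix (Fin (2 * d)) (Fin (2 * d)) ℝ) ∧ V = gaussianOp A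

/-- The channel `Φ_V : ρ ↦ V ρ V†`. -/
def unitaryChannel {n : Type*} [Fintype n] (V : Matrix n n ℂ) :
    Matrix n n ℂ →ₗ[ℂ] Matrix n n ℂ where
  toFun ρ := V * ρ * Vᴴ
  map_add' ρ σ := by rw [Matrix.mul_add, Matrix.add_mul]
  map_smul' c ρ := by simp

/-- The trace norm `tr √(X† X)`: the sum of the singular values of `X`. -/
def traceNorm {n : Type*} [Fintype n] [DecidableEq n] (X : Matrix n n ℂ) : ℝ :=
  ∑ i, √((Matrix.isHermitian_conjTranspose_mul_self X).eigenvalues i)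

/-- The map `Φ ⊗ id` on operators on the tensor product with an ancilla with basis `κ`: it
applies `Φ` to each block `(X_{(i,a),(j,b)})_{i,j}`. -/
def ampliation {n : Type*} (κ : Type*) (Φ : Matrix n n ℂ →ₗ[ℂ] Matrix n n ℂ)
    (X : Matrix (n × κ) (n × κ) ℂ) : Matrix (n × κ) (n × κ) ℂ :=
  Matrix.of fun p q =>
    Φ (Matrix.of fun i j => X (i, p.2) (j, q.2)) p.1 q.1

/-- The diamond norm: the supremum, over all finite-dimensional ancillas `ℂᵏ` and all operators
`X` with `‖X‖₁ ≤ 1`, of `‖(Φ ⊗ id)(X)‖₁`. The supremum is taken in `[0, ∞]`. -/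
def diamondNorm {n : Type*} [Fintype n] [DecidableEq n]
    (Φ : Matrix n n ℂ →ₗ[ℂ] Matrix n n ℂ) : ENNReal :=
  ⨆ (k : ℕ) (X : Matrix (n × Fin k) (n × Fin k) ℂ) (_ : traceNorm X ≤ 1),
    ENNReal.ofReal (traceNorm (ampliation (Fin k) Φ X))

/-- The operator norm of a real square matrix, with respect to the Euclidean norm. -/
def opNorm {n : Type*} [Fintype n] [DecidableEq n] (M : Matrix n n ℝ) : ℝ :=
  ‖Matrix.toEuclideanCLM (n := n) (𝕜 := ℝ) M‖

end FLO

end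

/-! Conjugation by `gaussianOp A` rotates Majorana operators by `exp A`, and the Fock representation
is irreducible. A unitary is therefore fixed up to a phase by its action on Majorana operators, and
a phase does not affect the channel. With R = O'ᵀO this gives V = c V'G, where G = `gaussianOp B`
for any antisymmetric logarithm B of R.

By duality between the trace norm and the operator norm, the diamond distance between the channels
of V'G and V' is at most 2‖G - 1‖: in the Heisenberg picture the difference is a commutator with G -
1, and the ancilla costs nothing. Since G is the exponential of a skew-adjoint operator, ‖G - 1‖ is
at most the norm of its exponent. Because m(v)² = |v|², that norm is at most 1/4 of the sum of the
2d Euclidean row norms of B.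

If ‖R - 1‖ < 1, the principal logarithm is real and has row norms at most 2‖R - 1‖
(`exists_antisymm_log`), so ‖G - 1‖ ≤ d‖R - 1‖, and ‖R - 1‖ = ‖O - O'‖. Otherwise the trivial bound
2 suffices. -/

noncomputable section

namespace FLO

open Matrix

/-! ### Canonical anticommutation relations and irreducibility of the Fock representation. -/

variable {d : ℕ}

/-- The Jordan-Wigner sign `(-1)^{#{k ∈ Y : k < j}}`. -/
def jwSign (j : Fin d) (Y : Finset (Fin d)) : ℂ := (-1) ^ (Y.filter (fun k => k < j)).card

lemma jwSign_mul_self (j : Fin d) (Y : Finset (Fin d)) : jwSign j Y * jwSign j Y = 1 := by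
  rw [jwSign, ← mul_pow]; norm_num

lemma jwSign_ne_zero (j : Fin d) (Y : Finset (Fin d)) : jwSign j Y ≠ 0 := by
  intro h; simpa [h] using jwSign_mul_self j Y

lemma star_jwSign (j : Fin d) (Y : Finset (Fin d)) : star (jwSign j Y) = jwSign j Y := by
  simp [jwSign]

lemma jwSign_insert {i j : Fin d} {Y : Finset (Fin d)} (hi : i ∉ Y) :
    jwSign j (insert i Y) = if i < j then -jwSign j Y else jwSign j Y := by
  unfold jwSign
  rw [Finset.filter_insert]
  split_ifs with h
  · rw [Finset.card_insert_of_notMem (by simp [hi]), pow_succ]; ring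
  · rfl

lemma mul_creation_apply (M : FockOp d) (j : Fin d) (X Y : Finset (Fin d)) :
    (M * creation j) X Y = if j ∈ Y then 0 else M X (insert j Y) * jwSign j Y := by
  rw [Matrix.mul_apply, Finset.sum_eq_single (insert j Y)]
  · by_cases h : j ∈ Y <;> simp [creation, h, jwSign]
  · intro Z _ hZ; simp [creation, hZ]
  · simp

lemma creation_mul_insert_apply (M : FockOp d) {j : Fin d} {X : Finset (Fin d)} (hj : j ∉ X)
    (Y : Finset (Fin d)) :
    (creation j * M) (insert j X) Y = jwSign j X * M X Y := by
  rw [Matrix.mul_apply, Finset.sum_eq_single X]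
  · simp [creation, hj, jwSign]
  · intro Z _ hZ
    simp only [creation, Matrix.of_apply]
    rw [if_neg, zero_mul]
    rintro ⟨h1, h2⟩
    exact hZ (by rw [← Finset.erase_insert h1, ← h2, Finset.erase_insert hj])
  · simp

lemma creation_mul_apply_of_notMem (M : FockOp d) {j : Fin d} {X : Finset (Fin d)} (hj : j ∉ X)
    (Y : Finset (Fin d)) :
    (creation j * M) X Y = 0 := by
  rw [Matrix.mul_apply]
  refine Finset.sum_eq_zero fun Z _ => ?_
  simp only [creation, Matrix.of_apply]
  rw [if_neg, zero_mul]
  rintro ⟨-, rfl⟩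
  simp at hj

lemma mul_annihilation_insert_apply (M : FockOp d) {j : Fin d} {Y : Finset (Fin d)} (hj : j ∉ Y)
    (X : Finset (Fin d)) :
    (M * annihilation j) X (insert j Y) = M X Y * jwSign j Y := by
  have := congrArg star (creation_mul_insert_apply Mᴴ hj X)
  rw [← conjTranspose_apply, conjTranspose_mul, conjTranspose_conjTranspose] at this
  rw [annihilation, this, star_mul, star_jwSign, conjTranspose_apply, star_star]

lemma annihilation_mul_apply (M : FockOp d) (j : Fin d) (X Y : Finset (Fin d)) :
    (annihilation j * M) X Y = if j ∈ X then 0 else jwSign j X * M (insert j X) Y := by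
  have := congrArg star (mul_creation_apply Mᴴ j Y X)
  rw [← conjTranspose_apply, conjTranspose_mul, conjTranspose_conjTranspose] at this
  rw [annihilation, this]
  split_ifs <;> simp [star_jwSign, mul_comm]

lemma annihilation_apply (j : Fin d) (X Y : Finset (Fin d)) :
    annihilation j X Y = if j ∉ X ∧ Y = insert j X then jwSign j X else 0 := by
  rw [annihilation, conjTranspose_apply, creation, Matrix.of_apply, apply_ite star, star_zero,
    ← jwSign, star_jwSign]

lemma creation_apply (j : Fin d) (X Y : Finset (Fin d)) :
    creation j X Y = if j ∉ Y ∧ X = insert j Y then jwSign j Y else 0 := rfl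

/-- For i ≠ j both products reach the same basis vector. In exactly one of the two orders the
smaller mode is already present when the sign of the larger one is counted, so the signs are
opposite. -/
lemma annihilation_anticomm (i j : Fin d) :
    annihilation i * annihilation j + annihilation j * annihilation i = (0 : FockOp d) := by
  ext X Y
  rw [Matrix.add_apply, annihilation_mul_apply, annihilation_mul_apply, Matrix.zero_apply]
  by_cases hij : i = j
  · subst hij
    simp [annihilation_apply]
  by_cases hi : i ∈ X
  · simp [hi, annihilation_apply]
  by_cases hj : j ∈ X
  · simp [hi, hj, annihilation_apply]
  have hji : j ≠ i := fun h => hij h.symm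
  simp only [hi, hj, annihilation_apply, Finset.mem_insert, hij, hji, or_self, if_false,
    not_false_eq_true, true_and, jwSign_insert]
  rw [Finset.insert_comm i j]
  by_cases hY : Y = insert j (insert i X)
  · simp only [hY, if_true]
    rcases lt_or_gt_of_ne hij with h | h
    · simp [h, h.not_gt]; ring
    · simp [h, h.not_gt]; ring
  · simp [hY]

lemma creation_anticomm (i j : Fin d) :
    creation i * creation j + creation j * creation i = (0 : FockOp d) := by
  have := congrArg conjTranspose (annihilation_anticomm j i)
  simpa [annihilation, conjTranspose_add, conjTranspose_mul] using this

lemma annihilation_creation_anticomm (i j : Fin d) :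
    annihilation i * creation j + creation j * annihilation i =
      if i = j then (1 : FockOp d) else 0 := by
  ext X Y
  rw [Matrix.add_apply, annihilation_mul_apply]
  by_cases hij : i = j
  · subst hij
    by_cases hi : i ∈ X
    · obtain ⟨Z, hZ, rfl⟩ : ∃ Z, i ∉ Z ∧ insert i Z = X :=
        ⟨X.erase i, by simp, Finset.insert_erase hi⟩
      rw [creation_mul_insert_apply _ hZ, annihilation_apply]
      by_cases hY : Y = insert i Z
      · subst hY; simp [hZ, jwSign_mul_self]
      · simp [hZ, hY, Ne.symm hY]
    · rw [creation_mul_apply_of_notMem _ hi]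
      simp only [hi, if_false, if_true, add_zero, creation_apply, Matrix.one_apply]
      by_cases hXY : X = Y
      · subst hXY; simp [hi, jwSign_mul_self]
      · rw [if_neg, if_neg hXY, mul_zero]
        rintro ⟨h1, h2⟩
        exact hXY (by rw [← Finset.erase_insert hi, h2, Finset.erase_insert h1])
  · have hji : j ≠ i := fun h => hij h.symm
    rw [if_neg hij, Matrix.zero_apply]
    by_cases hj : j ∈ X
    · obtain ⟨Z, hZ, rfl⟩ : ∃ Z, j ∉ Z ∧ insert j Z = X :=
        ⟨X.erase j, by simp, Finset.insert_erase hj⟩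
      rw [creation_mul_insert_apply _ hZ]
      by_cases hi : i ∈ Z
      · simp [hi, annihilation_apply]
      · simp only [Finset.mem_insert, hij, hi, or_self, if_false, annihilation_apply,
          not_false_eq_true, true_and, creation_apply, jwSign_insert hZ]
        by_cases hY : Y = insert i Z
        · subst hY
          simp only [Finset.mem_insert, hji, hZ, or_self, not_false_eq_true, true_and,
            Finset.insert_comm i j, if_true, jwSign_insert hi]
          rcases lt_or_gt_of_ne hij with h | h
          · simp [h, h.not_gt]; ring
          · simp [h, h.not_gt]; ring
        · have : ¬ (j ∉ Y ∧ insert i (insert j Z) = insert j Y) := by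
            rintro ⟨h1, h2⟩
            rw [Finset.insert_comm] at h2
            apply hY
            have := congrArg (fun S => S.erase j) h2
            simp only [Finset.erase_insert h1] at this
            rw [← this, Finset.erase_insert]
            simp [hZ, hji]
          rw [if_neg hY, if_neg this, mul_zero, mul_zero, add_zero]
    · rw [creation_mul_apply_of_notMem _ hj]
      by_cases hi : i ∈ X
      · simp [hi]
      · simp only [hi, if_false, creation_apply, add_zero, mul_eq_zero]
        right
        rw [if_neg]
        rintro ⟨h1, h2⟩
        have : j ∈ insert i X := by rw [h2]; simp
        simp [hji, hj] at this

/-- The Fock representation is irreducible: an operator that commutes with all creation and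
annihilation operators is a scalar. -/
lemma eq_smul_one_of_commute (M : FockOp d) (h1 : ∀ j, M * creation j = creation j * M)
    (h2 : ∀ j, M * annihilation j = annihilation j * M) : M = (M ∅ ∅) • (1 : FockOp d) := by
  -- Commuting with creation operators makes neighbouring diagonal entries equal, hence all equal to
  -- the vacuum entry.
  have hins : ∀ (j : Fin d) (X : Finset (Fin d)), j ∉ X →
      M (insert j X) (insert j X) = M X X := by
    intro j X hj
    have := congrFun (congrFun (h1 j) (insert j X)) X
    rw [mul_creation_apply, creation_mul_insert_apply _ hj, if_neg hj, mul_comm] at this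
    exact mul_left_cancel₀ (jwSign_ne_zero _ _) this
  have hdiag : ∀ X, M X X = M ∅ ∅ := by
    intro X
    induction X using Finset.induction_on with
    | empty => rfl
    | insert j X hj ih => rw [hins j X hj, ih]
  ext X Y
  by_cases hXY : X = Y
  · subst hXY; simp [hdiag X]
  rw [Matrix.smul_apply, Matrix.one_apply_ne hXY, smul_zero]
  -- For a mode j in exactly one of X and Y, one matrix entry of a commutation relation has `M X Y`,
  -- up to sign, on one side and 0 on the other.
  obtain ⟨j, hj⟩ : ∃ j, ¬ (j ∈ X ↔ j ∈ Y) := by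
    by_contra h; push Not at h; exact hXY (Finset.ext h)
  by_cases hjX : j ∈ X
  · have hjY : j ∉ Y := by tauto
    have := congrFun (congrFun (h2 j) X) (insert j Y)
    rw [mul_annihilation_insert_apply _ hjY, annihilation_mul_apply, if_pos hjX] at this
    exact (mul_eq_zero.1 this).resolve_right (jwSign_ne_zero _ _)
  · have hjY : j ∈ Y := by tauto
    have := congrFun (congrFun (h1 j) (insert j X)) Y
    rw [mul_creation_apply, creation_mul_insert_apply _ hjX, if_pos hjY] at this
    exact (mul_eq_zero.1 this.symm).resolve_left (jwSign_ne_zero _ _)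

/-! ### Majorana operators and the Clifford relations. -/

/-- The mode to which a Majorana index belongs. -/
def majoranaMode (k : Fin (2 * d)) : Fin d := ⟨k.val / 2, by have := k.isLt; omega⟩

lemma majorana_eq (k : Fin (2 * d)) : (majorana k : FockOp d) =
    if k.val % 2 = 0 then annihilation (majoranaMode k) + creation (majoranaMode k)
    else (-Complex.I) • (annihilation (majoranaMode k) - creation (majoranaMode k)) := rfl

lemma conjTranspose_majorana (k : Fin (2 * d)) : (majorana k : FockOp d)ᴴ = majorana k := by
  rw [majorana_eq]
  split_ifs
  · simp [annihilation, add_comm]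
  · simp [annihilation, ← smul_neg]

/-- In each parity case the expression is a signed sum of the four anticommutators `h1`–`h4`, times
the factors -i. -/
lemma majorana_anticomm (i j : Fin (2 * d)) :
    majorana i * majorana j + majorana j * majorana i =
      if i = j then (2 : FockOp d) else 0 := by
  have h1 := annihilation_anticomm (majoranaMode i) (majoranaMode j)
  have h2 := creation_anticomm (majoranaMode i) (majoranaMode j)
  have h3 := annihilation_creation_anticomm (majoranaMode i) (majoranaMode j)
  have h4 := annihilation_creation_anticomm (majoranaMode j) (majoranaMode i)
  have key : i = j ↔ majoranaMode i = majoranaMode j ∧ i.val % 2 = j.val % 2 := by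
    simp only [majoranaMode, Fin.ext_iff]; omega
  simp only [eq_comm (a := majoranaMode j)] at h4
  have hI : Complex.I * Complex.I = -1 := Complex.I_mul_I
  rw [majorana_eq, majorana_eq]
  generalize (annihilation (majoranaMode i) : FockOp d) = a at *
  generalize (annihilation (majoranaMode j) : FockOp d) = b at *
  generalize (creation (majoranaMode i) : FockOp d) = a' at *
  generalize (creation (majoranaMode j) : FockOp d) = b' at *
  rw [if_congr key rfl rfl]
  have two : (2 : FockOp d) = 1 + 1 := by norm_num
  by_cases hm : majoranaMode i = majoranaMode j
  · simp only [hm, if_true, true_and] at h3 h4 ⊢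
    rcases Nat.mod_two_eq_zero_or_one i.val with hi | hi <;>
    rcases Nat.mod_two_eq_zero_or_one j.val with hj | hj
    · simp only [hi, hj, if_true]
      calc _ = (a * b + b * a) + (a' * b' + b' * a') + (a * b' + b' * a) + (b * a' + a' * b) := by
            noncomm_ring
        _ = _ := by rw [h1, h2, h3, h4, two]; simp
    · simp only [hi, hj]
      simp only [if_true, one_ne_zero, zero_ne_one, if_false, mul_smul_comm, smul_mul_assoc,
        ← smul_add]
      convert smul_zero _
      calc _ = (a * b + b * a) - (a' * b' + b' * a') - (a * b' + b' * a) + (b * a' + a' * b) := by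
            noncomm_ring
        _ = _ := by rw [h1, h2, h3, h4]; simp
    · simp only [hi, hj]
      simp only [if_true, one_ne_zero, if_false, mul_smul_comm, smul_mul_assoc,
        ← smul_add]
      convert smul_zero _
      calc _ = (a * b + b * a) - (a' * b' + b' * a') + (a * b' + b' * a) - (b * a' + a' * b) := by
            noncomm_ring
        _ = _ := by rw [h1, h2, h3, h4]; simp
    · simp only [hi, hj]
      simp only [if_true, one_ne_zero, if_false, mul_smul_comm, smul_mul_assoc,
        ← smul_add, smul_smul, neg_mul_neg, hI]
      calc _ = (-1 : ℂ) • ((a * b + b * a) + (a' * b' + b' * a') - (a * b' + b' * a)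
              - (b * a' + a' * b)) := by
            congr 1; noncomm_ring
        _ = _ := by rw [h1, h2, h3, h4, two, neg_one_smul]; noncomm_ring
  · simp only [hm, if_false, false_and] at h3 h4 ⊢
    split_ifs with hi hj hj
    · calc _ = (a * b + b * a) + (a' * b' + b' * a') + (a * b' + b' * a) + (b * a' + a' * b) := by
            noncomm_ring
        _ = _ := by rw [h1, h2, h3, h4]; simp
    · simp only [mul_smul_comm, smul_mul_assoc, ← smul_add]
      convert smul_zero _
      calc _ = (a * b + b * a) - (a' * b' + b' * a') - (a * b' + b' * a) + (b * a' + a' * b) := by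
            noncomm_ring
        _ = _ := by rw [h1, h2, h3, h4]; simp
    · simp only [mul_smul_comm, smul_mul_assoc, ← smul_add]
      convert smul_zero _
      calc _ = (a * b + b * a) - (a' * b' + b' * a') + (a * b' + b' * a) - (b * a' + a' * b) := by
            noncomm_ring
        _ = _ := by rw [h1, h2, h3, h4]; simp
    · simp only [mul_smul_comm, smul_mul_assoc, ← smul_add, smul_smul, neg_mul_neg, hI]
      convert smul_zero _
      calc _ = (a * b + b * a) + (a' * b' + b' * a') - (a * b' + b' * a) - (b * a' + a' * b) := by
            noncomm_ring
        _ = _ := by rw [h1, h2, h3, h4]; simp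

lemma eq_smul_one_of_commute_majorana (M : FockOp d)
    (h : ∀ k, M * majorana k = majorana k * M) : M = (M ∅ ∅) • (1 : FockOp d) := by
  have key : ∀ j : Fin d,
      M * (annihilation j + creation j) = (annihilation j + creation j) * M ∧
      M * (annihilation j - creation j) = (annihilation j - creation j) * M := by
    intro j
    have h0 := h ⟨2 * j.val, by omega⟩
    have h1 := h ⟨2 * j.val + 1, by omega⟩
    have e0 : majoranaMode ⟨2 * j.val, by omega⟩ = j := by ext; simp [majoranaMode]
    have e1 : majoranaMode ⟨2 * j.val + 1, by omega⟩ = j := by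
      ext; simp [majoranaMode]; omega
    rw [majorana_eq, e0] at h0
    rw [majorana_eq, e1] at h1
    simp only [Nat.mul_mod_right, if_true] at h0
    have : (2 * j.val + 1) % 2 ≠ 0 := by omega
    simp only [this, if_false, mul_smul_comm, smul_mul_assoc] at h1
    exact ⟨h0, smul_right_injective _ (neg_ne_zero.2 Complex.I_ne_zero) h1⟩
  refine eq_smul_one_of_commute M (fun j => ?_) (fun j => ?_)
  · have e : (creation j : FockOp d) = (1 / 2 : ℂ) •
        ((annihilation j + creation j) - (annihilation j - creation j)) := by
      rw [add_sub_sub_cancel, ← two_smul ℂ, smul_smul]; norm_num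
    rw [e, mul_smul_comm, smul_mul_assoc, mul_sub, sub_mul, (key j).1, (key j).2]
  · have e : (annihilation j : FockOp d) = (1 / 2 : ℂ) •
        ((annihilation j + creation j) + (annihilation j - creation j)) := by
      rw [add_add_sub_cancel, ← two_smul ℂ, smul_smul]; norm_num
    rw [e, mul_smul_comm, smul_mul_assoc, mul_add, add_mul, (key j).1, (key j).2]

end FLO
end

noncomputable section

namespace FLO

open Matrix
open scoped Matrix.Norms.L2Operator

/-! ### Exponentials: intertwining and distance from the identity. -/

section Exponential

/-- If `L` intertwines left multiplication by `A` with the commutator by `K`, then it intertwines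
left multiplication by `exp A` with conjugation by `exp K`. -/
lemma map_exp_mul_mul_exp {𝔸 𝔹 : Type*} [NormedRing 𝔸] [NormedAlgebra ℝ 𝔸] [CompleteSpace 𝔸]
    [NormedRing 𝔹] [NormedAlgebra ℝ 𝔹] [CompleteSpace 𝔹] (L : 𝔹 →L[ℝ] 𝔸) (A : 𝔹) (K : 𝔸)
    (h : ∀ B, K * L B - L B * K = L (A * B)) (B : 𝔹) :
    L (NormedSpace.exp A * B) * NormedSpace.exp K = NormedSpace.exp K * L B := by
  -- The derivative is exp(-tK) (L(A e^{tA} B) - [K, L(e^{tA} B)]) exp(tK), which vanishes by `h`.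
  -- The claim compares t = 1 with t = 0.
  let f : ℝ → 𝔸 := fun t =>
    NormedSpace.exp (t • (-K)) * (L (NormedSpace.exp (t • A) * B) * NormedSpace.exp (t • K))
  have hf : ∀ t, HasDerivAt f 0 t := by
    intro t
    have h1 := hasDerivAt_exp_smul_const (𝕂 := ℝ) (-K) t
    have h2 := hasDerivAt_exp_smul_const' (𝕂 := ℝ) A t
    have h3 := hasDerivAt_exp_smul_const' (𝕂 := ℝ) K t
    have h4 := L.hasFDerivAt.comp_hasDerivAt t (h2.mul_const B)
    have h5 := h1.mul (h4.mul h3)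
    refine h5.congr_deriv ?_
    simp only [Pi.mul_apply, mul_assoc, Function.comp]
    rw [← h (NormedSpace.exp (t • A) * B)]
    noncomm_ring
  have hconst := is_const_of_deriv_eq_zero (fun t => (hf t).differentiableAt)
    (fun t => (hf t).deriv) 1 0
  simp only [f, one_smul, zero_smul, NormedSpace.exp_zero, one_mul, mul_one] at hconst
  let _ : NormedAlgebra ℚ 𝔸 := NormedAlgebra.restrictScalars ℚ ℝ 𝔸
  have hinv : NormedSpace.exp K * NormedSpace.exp (-K) = 1 := by
    rw [← NormedSpace.exp_add_of_commute (Commute.refl K).neg_right, add_neg_cancel,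
      NormedSpace.exp_zero]
  rw [← hconst, ← mul_assoc, hinv, one_mul]

/-- The path t ↦ exp(tK) consists of unitaries, so it has constant speed ‖K‖ on [0, 1]. -/
lemma norm_exp_sub_one_le_of_skewAdjoint {𝔸 : Type*} [CStarAlgebra 𝔸] {K : 𝔸}
    (hK : star K = -K) : ‖NormedSpace.exp K - 1‖ ≤ ‖K‖ := by
  let _ : NormedAlgebra ℝ 𝔸 := NormedAlgebra.restrictScalars ℝ ℂ 𝔸
  let _ : NormedAlgebra ℚ 𝔸 := NormedAlgebra.restrictScalars ℚ ℂ 𝔸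
  nontriviality 𝔸
  have hU : ∀ t : ℝ, NormedSpace.exp (t • K) ∈ unitary 𝔸 := fun t =>
    NormedSpace.exp_mem_unitary_of_mem_skewAdjoint (by
      rw [skewAdjoint.mem_iff, star_smul, hK]; simp)
  have := norm_image_sub_le_of_norm_deriv_le_segment_01' (C := ‖K‖)
    (f := fun t : ℝ => NormedSpace.exp (t • K)) (f' := fun t => NormedSpace.exp (t • K) * K)
    (fun t _ => (hasDerivAt_exp_smul_const (𝕂 := ℝ) K t).hasDerivWithinAt)
    (fun t _ => by rw [CStarRing.norm_mem_unitary_mul _ (hU t)])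
  simpa using this

end Exponential

/-! ### Quadratic Hamiltonians and their action on Majorana vectors. -/

variable {d : ℕ}

/-- The Majorana operator `m(v) = ∑ₖ vₖ mₖ` of a real vector. -/
def majoranaVec : (Fin (2 * d) → ℝ) →ₗ[ℝ] FockOp d where
  toFun v := ∑ k, (v k : ℂ) • majorana k
  map_add' v w := by simp [add_smul, Finset.sum_add_distrib]
  map_smul' c v := by simp [mul_smul, Finset.smul_sum]

lemma majoranaVec_apply (v : Fin (2 * d) → ℝ) :
    majoranaVec v = ∑ k, (v k : ℂ) • (majorana k : FockOp d) := rfl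

lemma majoranaVec_single (k : Fin (2 * d)) :
    majoranaVec (Pi.single k 1) = (majorana k : FockOp d) := by
  rw [majoranaVec_apply, Finset.sum_eq_single k]
  · simp
  · intro j _ hj; simp [hj]
  · simp

lemma conjTranspose_majoranaVec (v : Fin (2 * d) → ℝ) :
    (majoranaVec v : FockOp d)ᴴ = majoranaVec v := by
  simp [majoranaVec_apply, conjTranspose_sum, conjTranspose_majorana]

lemma majoranaVec_anticomm_majorana (v : Fin (2 * d) → ℝ) (k : Fin (2 * d)) :
    majoranaVec v * majorana k + majorana k * majoranaVec v = (2 * v k : ℂ) • (1 : FockOp d) := by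
  rw [majoranaVec_apply, Finset.sum_mul, Finset.mul_sum, ← Finset.sum_add_distrib]
  simp only [smul_mul_assoc, mul_smul_comm, ← smul_add, majorana_anticomm]
  rw [Finset.sum_eq_single k]
  · rw [if_pos rfl, mul_comm, mul_smul, two_smul]; norm_num
  · intro j _ hj; simp [hj]
  · simp

lemma majoranaVec_mul_self (v : Fin (2 * d) → ℝ) :
    majoranaVec v * majoranaVec v = ((∑ k, v k ^ 2 : ℝ) : ℂ) • (1 : FockOp d) := by
  have h2 : (2 : ℂ) • (majoranaVec v * majoranaVec v : FockOp d) =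
      (2 : ℂ) • ((∑ k, v k ^ 2 : ℝ) : ℂ) • (1 : FockOp d) := by
    rw [two_smul]
    conv_lhs =>
      enter [1, 2]
      rw [majoranaVec_apply]
    conv_lhs =>
      enter [2, 1]
      rw [majoranaVec_apply]
    rw [Finset.mul_sum, Finset.sum_mul, ← Finset.sum_add_distrib]
    simp only [smul_mul_assoc, mul_smul_comm, ← smul_add, majoranaVec_anticomm_majorana]
    simp only [smul_smul, ← Finset.sum_smul]
    congr 1
    push_cast
    rw [Finset.mul_sum]
    exact Finset.sum_congr rfl fun k _ => by ring
  exact smul_right_injective _ (two_ne_zero' ℂ) h2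

/-- m(v) is self-adjoint with scalar square |v|², so the C*-identity applies. -/
lemma norm_majoranaVec_le (v : Fin (2 * d) → ℝ) :
    ‖(majoranaVec v : FockOp d)‖ ≤ √(∑ k, v k ^ 2) := by
  apply Real.le_sqrt_of_sq_le
  have h := CStarRing.norm_star_mul_self (x := (majoranaVec v : FockOp d))
  rw [star_eq_conjTranspose, conjTranspose_majoranaVec, majoranaVec_mul_self, norm_smul,
    norm_one, mul_one] at h
  rw [sq, ← h, Complex.norm_real, Real.norm_of_nonneg (by positivity)]

lemma norm_majorana_le (k : Fin (2 * d)) : ‖(majorana k : FockOp d)‖ ≤ 1 := by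
  rw [← majoranaVec_single]
  refine (norm_majoranaVec_le _).trans ?_
  rw [Finset.sum_eq_single k]
  · simp
  · intro j _ hj; simp [hj]
  · simp

/-- The quadratic Hamiltonian `1/4 ∑_{i,j} A_{ij} m_i m_j`. -/
def quadraticOp (A : Matrix (Fin (2 * d)) (Fin (2 * d)) ℝ) : FockOp d :=
  (1 / 4 : ℂ) • ∑ i, ∑ j, (A i j : ℂ) • (majorana i * majorana j)

lemma gaussianOp_eq (A : Matrix (Fin (2 * d)) (Fin (2 * d)) ℝ) :
    gaussianOp A = NormedSpace.exp (quadraticOp A) := rfl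

lemma quadraticOp_eq (A : Matrix (Fin (2 * d)) (Fin (2 * d)) ℝ) :
    quadraticOp A = (1 / 4 : ℂ) • ∑ i, majorana i * majoranaVec (A i) := by
  simp only [quadraticOp, majoranaVec_apply, Finset.mul_sum, mul_smul_comm]

/-- Summing over j first turns each row into one product m_i m(A_i), which costs the Euclidean norm
of the row and not its ℓ¹ norm. This keeps the final bound linear in d. -/
lemma norm_quadraticOp_le (A : Matrix (Fin (2 * d)) (Fin (2 * d)) ℝ) :
    ‖quadraticOp A‖ ≤ 1 / 4 * ∑ i, √(∑ j, A i j ^ 2) := by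
  rw [quadraticOp_eq, norm_smul]
  norm_num
  refine (norm_sum_le _ _).trans (Finset.sum_le_sum fun i _ => (norm_mul_le _ _).trans ?_)
  calc _ ≤ 1 * √(∑ j, A i j ^ 2) := by
        gcongr
        · exact norm_majorana_le i
        · exact norm_majoranaVec_le (A i)
    _ = _ := one_mul _

lemma conjTranspose_quadraticOp {A : Matrix (Fin (2 * d)) (Fin (2 * d)) ℝ} (hA : Aᵀ = -A) :
    (quadraticOp A)ᴴ = -quadraticOp A := by
  have hA' : ∀ i j, A i j = -A j i := fun i j => by
    have := congrFun (congrFun hA j) i; simpa using this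
  simp only [quadraticOp, conjTranspose_smul, conjTranspose_sum, conjTranspose_mul,
    conjTranspose_majorana]
  rw [Finset.sum_comm, ← smul_neg, ← Finset.sum_neg_distrib]
  simp only [← Finset.sum_neg_distrib, ← neg_smul]
  refine congrArg₂ _ (by simp) (Finset.sum_congr rfl fun i _ => Finset.sum_congr rfl fun j _ => ?_)
  rw [hA' j i]
  simp

/-- Commuting with a quadratic Hamiltonian acts linearly on the Majorana operators. -/
lemma quadraticOp_commutator {A : Matrix (Fin (2 * d)) (Fin (2 * d)) ℝ} (hA : Aᵀ = -A)
    (v : Fin (2 * d) → ℝ) :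
    quadraticOp A * majoranaVec v - majoranaVec v * quadraticOp A = majoranaVec (A *ᵥ v) := by
  have hA' : ∀ i j, A i j = -A j i := fun i j => by
    have := congrFun (congrFun hA j) i; simpa using this
  have hv : ∀ (k : Fin (2 * d)), majoranaVec v * majorana k =
      (2 * v k : ℂ) • (1 : FockOp d) - majorana k * majoranaVec v := fun k =>
    eq_sub_of_add_eq (majoranaVec_anticomm_majorana v k)
  have hterm : ∀ i j, (majorana i * majorana j) * majoranaVec v -
      majoranaVec v * (majorana i * majorana j) =
      (2 * v j : ℂ) • majorana i - (2 * v i : ℂ) • (majorana j : FockOp d) := by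
    intro i j
    have h1 : majorana j * majoranaVec v =
        (2 * v j : ℂ) • (1 : FockOp d) - majoranaVec v * majorana j := by rw [hv j]; abel
    rw [mul_assoc, h1, ← mul_assoc, hv i, mul_sub, sub_mul, mul_smul_comm, smul_mul_assoc, mul_one,
      one_mul]
    rw [mul_assoc]
    abel
  rw [quadraticOp, smul_mul_assoc, mul_smul_comm, ← smul_sub, Finset.sum_mul, Finset.mul_sum,
    ← Finset.sum_sub_distrib]
  simp only [Finset.sum_mul, Finset.mul_sum, ← Finset.sum_sub_distrib, smul_mul_assoc,
    mul_smul_comm, ← smul_sub, hterm]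
  simp only [smul_sub, Finset.sum_sub_distrib]
  have hswap : ∑ i, ∑ j, (A i j : ℂ) • (2 * v i : ℂ) • (majorana j : FockOp d) =
      - ∑ i, ∑ j, (A i j : ℂ) • (2 * v j : ℂ) • (majorana i : FockOp d) := by
    rw [Finset.sum_comm, ← Finset.sum_neg_distrib]
    refine Finset.sum_congr rfl fun i _ => ?_
    rw [← Finset.sum_neg_distrib]
    refine Finset.sum_congr rfl fun j _ => ?_
    rw [hA' j i]
    simp
  rw [← smul_sub, hswap, sub_neg_eq_add, ← two_smul ℂ, smul_smul, majoranaVec_apply,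
    Finset.smul_sum]
  refine Finset.sum_congr rfl fun i _ => ?_
  simp only [smul_smul, ← Finset.sum_smul, Matrix.mulVec, dotProduct]
  congr 1
  push_cast
  rw [Finset.mul_sum]
  exact Finset.sum_congr rfl fun j _ => by ring

lemma gaussianOp_mem_unitary {A : Matrix (Fin (2 * d)) (Fin (2 * d)) ℝ} (hA : Aᵀ = -A) :
    gaussianOp A ∈ unitary (FockOp d) := by
  let _ : NormedAlgebra ℚ (FockOp d) := NormedAlgebra.restrictScalars ℚ ℂ _
  rw [gaussianOp_eq]
  exact NormedSpace.exp_mem_unitary_of_mem_skewAdjoint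
    (by rw [skewAdjoint.mem_iff, star_eq_conjTranspose, conjTranspose_quadraticOp hA])

lemma majoranaVec_mul_gaussianOp {A : Matrix (Fin (2 * d)) (Fin (2 * d)) ℝ} (hA : Aᵀ = -A)
    (v : Fin (2 * d) → ℝ) :
    majoranaVec (NormedSpace.exp A *ᵥ v) * gaussianOp A = gaussianOp A * majoranaVec v := by
  -- Letting L act on matrices, not vectors, makes v ↦ Av a left multiplication, as
  -- `map_exp_mul_mul_exp` requires; it is then used at B = 1.
  let L : Matrix (Fin (2 * d)) (Fin (2 * d)) ℝ →ₗ[ℝ] FockOp d :=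
    majoranaVec ∘ₗ (Matrix.mulVecBilin ℝ ℝ).flip v
  have hL : ∀ B, L B = majoranaVec (B *ᵥ v) := fun B => rfl
  have := map_exp_mul_mul_exp (LinearMap.toContinuousLinearMap L) A (quadraticOp A)
    (fun B => by
      simp only [LinearMap.coe_toContinuousLinearMap', hL]
      rw [quadraticOp_commutator hA, mulVec_mulVec]) 1
  rw [gaussianOp_eq]
  simpa only [LinearMap.coe_toContinuousLinearMap', hL, mul_one, one_mulVec] using this

lemma norm_gaussianOp_sub_one_le {A : Matrix (Fin (2 * d)) (Fin (2 * d)) ℝ} (hA : Aᵀ = -A) :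
    ‖gaussianOp A - 1‖ ≤ 1 / 4 * ∑ i, √(∑ j, A i j ^ 2) :=
  (norm_exp_sub_one_le_of_skewAdjoint (conjTranspose_quadraticOp hA)).trans
    (norm_quadraticOp_le A)

/-- Unitaries that act in the same way on the Majorana operators differ by a phase. -/
lemma exists_phase_of_same_action {U W : FockOp d} (hU : U ∈ unitary (FockOp d))
    (hW : W ∈ unitary (FockOp d)) (R : Matrix (Fin (2 * d)) (Fin (2 * d)) ℝ)
    (h1 : ∀ v, majoranaVec (R *ᵥ v) * U = U * majoranaVec v)
    (h2 : ∀ v, majoranaVec (R *ᵥ v) * W = W * majoranaVec v) :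
    ∃ c : ℂ, star c * c = 1 ∧ U = c • W := by
  have hW' : W * star W = 1 := (Unitary.mem_iff.1 hW).2
  have hW'' : star W * W = 1 := (Unitary.mem_iff.1 hW).1
  -- W†U commutes with every Majorana operator, so irreducibility makes it a scalar.
  have hcomm : ∀ v, (star W * U) * majoranaVec v = majoranaVec v * (star W * U) := by
    intro v
    have h3 : star W * majoranaVec (R *ᵥ v) = majoranaVec v * star W := by
      calc _ = star W * (majoranaVec (R *ᵥ v) * W) * star W := by
            simp only [mul_assoc, hW', mul_one]
        _ = (star W * W) * majoranaVec v * star W := by rw [h2]; simp only [mul_assoc]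
        _ = _ := by rw [hW'', one_mul]
    rw [mul_assoc, ← h1, ← mul_assoc, h3, mul_assoc]
  have hs := eq_smul_one_of_commute_majorana (star W * U)
    (fun k => by simpa only [majoranaVec_single] using hcomm (Pi.single k 1))
  generalize (star W * U) ∅ ∅ = c at hs
  refine ⟨c, ?_, ?_⟩
  · have h4 : star (star W * U) * (star W * U) = 1 :=
      (Unitary.mem_iff.1 (mul_mem (Unitary.star_mem hW) hU)).1
    rw [hs, star_smul, star_one, smul_mul_smul_comm, one_mul] at h4
    have := congrFun (congrFun h4 ∅) ∅
    simpa using this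
  · calc U = W * (star W * U) := by rw [← mul_assoc, hW', one_mul]
      _ = _ := by rw [hs, mul_smul_comm, mul_one]

open scoped Kronecker

/-! ### Duality between the trace norm and the operator norm. -/

section TraceNorm

variable {n : Type*} [Fintype n] [DecidableEq n]

lemma trace_eq_sum_inner_eigenvectorBasis {P : Matrix n n ℂ} (hP : P.IsHermitian)
    (M : Matrix n n ℂ) :
    M.trace = ∑ i, inner ℂ (hP.eigenvectorBasis i)
      (Matrix.toEuclideanCLM (n := n) (𝕜 := ℂ) M (hP.eigenvectorBasis i)) := by
  rw [← Matrix.trace_toLin_eq M (EuclideanSpace.basisFun n ℂ).toBasis,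
    LinearMap.trace_eq_sum_inner _ hP.eigenvectorBasis]
  rfl

lemma norm_mulVec_eigenvectorBasis (X : Matrix n n ℂ) (i : n) :
    ‖Matrix.toEuclideanCLM (n := n) (𝕜 := ℂ) X
      ((isHermitian_conjTranspose_mul_self X).eigenvectorBasis i)‖ =
      √((isHermitian_conjTranspose_mul_self X).eigenvalues i) := by
  set hX := isHermitian_conjTranspose_mul_self X
  have h1 : Matrix.toEuclideanCLM (n := n) (𝕜 := ℂ) (Xᴴ * X) (hX.eigenvectorBasis i) =
      (hX.eigenvalues i : ℂ) • hX.eigenvectorBasis i := by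
    ext j
    have := congrFun (hX.mulVec_eigenvectorBasis i) j
    simpa [ofLp_toEuclideanCLM] using this
  have h2 : ‖Matrix.toEuclideanCLM (n := n) (𝕜 := ℂ) X (hX.eigenvectorBasis i)‖ ^ 2 =
      hX.eigenvalues i := by
    have h3 : inner ℂ (Matrix.toEuclideanCLM (n := n) (𝕜 := ℂ) X (hX.eigenvectorBasis i))
        (Matrix.toEuclideanCLM (n := n) (𝕜 := ℂ) X (hX.eigenvectorBasis i)) =
        (hX.eigenvalues i : ℂ) := by
      rw [← ContinuousLinearMap.adjoint_inner_right, ← ContinuousLinearMap.star_eq_adjoint,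
        ← map_star, ← mul_apply_eq_comp, ← map_mul, star_eq_conjTranspose, h1,
        inner_smul_right, inner_self_eq_norm_sq_to_K]
      simp
    rw [inner_self_eq_norm_sq_to_K] at h3
    exact Complex.ofReal_injective (by simpa using h3)
  rw [← h2, Real.sqrt_sq (norm_nonneg _)]

/-- In an eigenbasis (e_i) of X†X the vector X e_i has the i-th singular value as its norm, so each
diagonal term of the trace is at most ‖A‖ times that singular value. -/
lemma norm_trace_mul_le (A X : Matrix n n ℂ) : ‖(A * X).trace‖ ≤ ‖A‖ * traceNorm X := by
  rw [trace_eq_sum_inner_eigenvectorBasis (isHermitian_conjTranspose_mul_self X), traceNorm,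
    Finset.mul_sum]
  refine (norm_sum_le _ _).trans (Finset.sum_le_sum fun i _ => ?_)
  refine (norm_inner_le_norm _ _).trans ?_
  rw [OrthonormalBasis.norm_eq_one, one_mul, map_mul, mul_apply_eq_comp]
  refine (ContinuousLinearMap.le_opNorm _ _).trans ?_
  rw [norm_mulVec_eigenvectorBasis, l2_opNorm_toEuclideanCLM]

/-- The optimal A comes from the polar decomposition: A = G X† with G the pseudo-inverse of √(X†X).
-/
lemma exists_trace_mul_eq_traceNorm (X : Matrix n n ℂ) :
    ∃ A : Matrix n n ℂ, ‖A‖ ≤ 1 ∧ (A * X).trace = traceNorm X := by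
  set hX := isHermitian_conjTranspose_mul_self X
  set lam := hX.eigenvalues
  set U : Matrix n n ℂ := hX.eigenvectorUnitary.1
  have hUm : U ∈ unitary (Matrix n n ℂ) := hX.eigenvectorUnitary.2
  have hU1 : star U * U = 1 := (Unitary.mem_iff.1 hUm).1
  have hU2 : U * star U = 1 := (Unitary.mem_iff.1 hUm).2
  have hspec : star X * X = U * diagonal (fun i => (lam i : ℂ)) * star U := hX.spectral_theorem
  -- Since 0⁻¹ = 0, the kernel of X needs no separate treatment.
  set g : n → ℂ := fun i => ((√(lam i))⁻¹ : ℝ)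
  set G : Matrix n n ℂ := U * diagonal g * star U
  have hG : star G = G := by
    have : star (diagonal g) = diagonal g := by
      rw [star_eq_conjTranspose, diagonal_conjTranspose]
      congr 1; ext i; simp [g]
    simp only [G, star_mul, star_star, this, mul_assoc]
  have hGP : G * (star X * X) = U * diagonal (fun i => ((√(lam i) : ℝ) : ℂ)) * star U := by
    rw [hspec]
    calc _ = U * diagonal g * (star U * U) * diagonal (fun i => (lam i : ℂ)) * star U := by
          simp only [G, mul_assoc]
      _ = _ := by
        rw [hU1, mul_one, mul_assoc U, diagonal_mul_diagonal]
        congr 3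
        ext i
        simp only [g]
        rw [← Complex.ofReal_mul]
        congr 1
        rw [inv_mul_eq_div, Real.div_sqrt]
  refine ⟨G * star X, ?_, ?_⟩
  · have h1 : (G * star X) * star (G * star X) =
        U * diagonal (fun i => ((√(lam i) * (√(lam i))⁻¹ : ℝ) : ℂ)) * star U := by
      calc _ = (G * (star X * X)) * G := by
            rw [star_mul, star_star, hG]; simp only [mul_assoc]
        _ = U * diagonal (fun i => ((√(lam i) : ℝ) : ℂ)) * (star U * U) * diagonal g * star U := by
            rw [hGP]; simp only [G, mul_assoc]
        _ = _ := by
          rw [hU1, mul_one, mul_assoc U, diagonal_mul_diagonal]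
          simp only [g, Complex.ofReal_mul]
    have h2 : ‖(G * star X) * star (G * star X)‖ ≤ 1 := by
      rw [h1, CStarRing.norm_mul_mem_unitary _ (Unitary.star_mem hUm),
        CStarRing.norm_mem_unitary_mul _ hUm, l2_opNorm_diagonal,
        pi_norm_le_iff_of_nonneg zero_le_one]
      intro i
      rw [Complex.norm_real]
      by_cases h : √(lam i) = 0
      · simp [h]
      · simp [mul_inv_cancel₀ h]
    rw [CStarRing.norm_self_mul_star] at h2
    nlinarith [norm_nonneg (G * star X)]
  · rw [mul_assoc, hGP, trace_mul_comm, ← mul_assoc, hU1, one_mul, trace_diagonal, traceNorm]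
    push_cast
    rfl

lemma traceNorm_nonneg (X : Matrix n n ℂ) : 0 ≤ traceNorm X :=
  Finset.sum_nonneg fun _ _ => Real.sqrt_nonneg _

/-- Pairing with the norming operator A and cycling the trace moves the conjugations from X to A. -/
lemma traceNorm_conj_sub_conj_le (V W X : Matrix n n ℂ) {ε : ℝ}
    (h : ∀ A : Matrix n n ℂ, ‖A‖ ≤ 1 → ‖star V * A * V - star W * A * W‖ ≤ ε) :
    traceNorm (V * X * star V - W * X * star W) ≤ ε * traceNorm X := by
  obtain ⟨A, hA, hAX⟩ := exists_trace_mul_eq_traceNorm (V * X * star V - W * X * star W)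
  have h1 : (A * (V * X * star V - W * X * star W)).trace =
      ((star V * A * V - star W * A * W) * X).trace := by
    rw [mul_sub, sub_mul, trace_sub, trace_sub]
    congr 1
    · rw [← mul_assoc, trace_mul_comm]; simp only [mul_assoc]
    · rw [← mul_assoc, trace_mul_comm]; simp only [mul_assoc]
  have h2 := norm_trace_mul_le (star V * A * V - star W * A * W) X
  rw [← h1, hAX, Complex.norm_real, Real.norm_of_nonneg (traceNorm_nonneg _)] at h2
  exact h2.trans (mul_le_mul_of_nonneg_right (h A hA) (traceNorm_nonneg _))

end TraceNorm

/-! ### Ancillas and diamond-norm bounds for unitary channels. -/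

section Ampliation

variable {n κ : Type*} [Fintype n] [DecidableEq n] [Fintype κ] [DecidableEq κ]

/-- The embedding `V ↦ V ⊗ 1` of operators into the operators with an ancilla. -/
def kroneckerOneHom (n κ : Type*) [Fintype n] [DecidableEq n] [Fintype κ] [DecidableEq κ] :
    Matrix n n ℂ →⋆ₐ[ℂ] Matrix (n × κ) (n × κ) ℂ where
  toFun V := V ⊗ₖ (1 : Matrix κ κ ℂ)
  map_one' := one_kronecker_one
  map_mul' V W := by rw [← mul_kronecker_mul, mul_one]
  map_zero' := zero_kronecker _
  map_add' V W := add_kronecker _ _ _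
  commutes' r := by
    rw [Algebra.algebraMap_eq_smul_one, smul_kronecker, one_kronecker_one,
      Algebra.algebraMap_eq_smul_one]
  map_star' V := by
    rw [star_eq_conjTranspose, star_eq_conjTranspose, conjTranspose_kronecker, conjTranspose_one]

lemma ampliation_unitaryChannel (V : Matrix n n ℂ) (X : Matrix (n × κ) (n × κ) ℂ) :
    ampliation κ (unitaryChannel V) X =
      kroneckerOneHom n κ V * X * star (kroneckerOneHom n κ V) := by
  ext p q
  simp only [ampliation, unitaryChannel, kroneckerOneHom, LinearMap.coe_mk, AddHom.coe_mk,
    Matrix.of_apply, Matrix.mul_apply, StarAlgHom.coe_mk', AlgHom.coe_mk, RingHom.coe_mk,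
    MonoidHom.coe_mk, OneHom.coe_mk, Matrix.star_apply, Matrix.conjTranspose_apply,
    Fintype.sum_prod_type, kroneckerMap_apply]
  simp [Matrix.one_apply, apply_ite (starRingEnd ℂ)]

lemma diamondNorm_sub_le (V W : Matrix n n ℂ) {ε : ℝ} (hε : 0 ≤ ε)
    (h : ∀ (k : ℕ) (A : Matrix (n × Fin k) (n × Fin k) ℂ), ‖A‖ ≤ 1 →
      ‖star (kroneckerOneHom n (Fin k) V) * A * kroneckerOneHom n (Fin k) V -
        star (kroneckerOneHom n (Fin k) W) * A * kroneckerOneHom n (Fin k) W‖ ≤ ε) :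
    diamondNorm (unitaryChannel V - unitaryChannel W) ≤ ENNReal.ofReal ε := by
  refine iSup_le fun k => iSup_le fun X => iSup_le fun hX => ENNReal.ofReal_le_ofReal ?_
  have h1 : ampliation (Fin k) (unitaryChannel V - unitaryChannel W) X =
      ampliation (Fin k) (unitaryChannel V) X - ampliation (Fin k) (unitaryChannel W) X := by
    ext p q; simp [ampliation]
  rw [h1, ampliation_unitaryChannel, ampliation_unitaryChannel]
  exact (traceNorm_conj_sub_conj_le _ _ X (h k)).trans
    (mul_le_of_le_one_right hε hX)

lemma norm_star_mul_mul_le {𝔸 : Type*} [CStarAlgebra 𝔸] {V A : 𝔸} (hV : V ∈ unitary 𝔸)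
    (hA : ‖A‖ ≤ 1) : ‖star V * A * V‖ ≤ 1 := by
  rwa [CStarRing.norm_mul_mem_unitary _ hV, CStarRing.norm_mem_unitary_mul _ (Unitary.star_mem hV)]

lemma diamondNorm_sub_le_two {V W : Matrix n n ℂ} (hV : V ∈ unitary (Matrix n n ℂ))
    (hW : W ∈ unitary (Matrix n n ℂ)) :
    diamondNorm (unitaryChannel V - unitaryChannel W) ≤ ENNReal.ofReal 2 := by
  refine diamondNorm_sub_le V W zero_le_two fun k A hA => (norm_sub_le _ _).trans ?_
  have h1 := norm_star_mul_mul_le (Unitary.map_mem (kroneckerOneHom n (Fin k)) hV) hA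
  have h2 := norm_star_mul_mul_le (Unitary.map_mem (kroneckerOneHom n (Fin k)) hW) hA
  linarith

lemma diamondNorm_mul_sub_le {W G : Matrix n n ℂ} (hG : G ∈ unitary (Matrix n n ℂ))
    (hW : W ∈ unitary (Matrix n n ℂ)) :
    diamondNorm (unitaryChannel (W * G) - unitaryChannel W) ≤ ENNReal.ofReal (2 * ‖G - 1‖) := by
  refine diamondNorm_sub_le _ W (by positivity) fun k A hA => ?_
  set φ := kroneckerOneHom n (Fin k)
  have hφG := Unitary.map_mem φ hG
  have hB := norm_star_mul_mul_le (Unitary.map_mem φ hW) hA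
  set B := star (φ W) * A * φ W
  -- A *-homomorphism of C*-algebras is contractive, so the bound is uniform in the ancilla.
  have h1 : ‖φ G - 1‖ ≤ ‖G - 1‖ := by
    rw [← map_one φ, ← map_sub]
    exact NonUnitalStarAlgHom.norm_apply_le φ _
  -- The difference is a unitary times the commutator of B with φ(G) - 1; its two terms give the
  -- factor 2.
  have e : star (φ (W * G)) * A * φ (W * G) - B =
      star (φ G) * (B * (φ G - 1) - (φ G - 1) * B) := by
    have hu : star (φ G) * φ G = 1 := (Unitary.mem_iff.1 hφG).1
    have e1 : star (φ G) * (B * (φ G - 1) - (φ G - 1) * B) =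
        star (φ G) * B * φ G - (star (φ G) * φ G) * B := by noncomm_ring
    rw [e1, hu, one_mul, map_mul, star_mul]
    simp only [B, mul_assoc]
  rw [e, CStarRing.norm_mem_unitary_mul _ (Unitary.star_mem hφG)]
  refine (norm_sub_le _ _).trans ?_
  have h2 := norm_mul_le B (φ G - 1)
  have h3 := norm_mul_le (φ G - 1) B
  have h4 := norm_nonneg (φ G - 1)
  nlinarith

lemma unitaryChannel_smul (W : Matrix n n ℂ) {c : ℂ} (hc : star c * c = 1) :
    unitaryChannel (c • W) = unitaryChannel W := by
  ext1 X
  simp only [unitaryChannel, LinearMap.coe_mk, AddHom.coe_mk, conjTranspose_smul, smul_mul_assoc,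
    mul_smul_comm, smul_smul, hc, one_smul]

end Ampliation

/-! ### Real antisymmetric logarithms of orthogonal matrices near the identity. -/

section RealLogarithm

variable {n : Type*} [Fintype n] [DecidableEq n]

lemma sum_norm_sq_mulVec_le {𝕜 : Type*} [RCLike 𝕜] (M : Matrix n n 𝕜) (v : n → 𝕜) :
    ∑ i, ‖(M *ᵥ v) i‖ ^ 2 ≤ ‖M‖ ^ 2 * ∑ i, ‖v i‖ ^ 2 := by
  have h := l2_opNorm_mulVec M (WithLp.toLp 2 v)
  have h2 := pow_le_pow_left₀ (norm_nonneg _) h 2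
  rw [mul_pow, EuclideanSpace.norm_sq_eq, EuclideanSpace.norm_sq_eq] at h2
  exact h2

lemma l2_opNorm_le_of_sum_norm_sq {𝕜 : Type*} [RCLike 𝕜] (M : Matrix n n 𝕜) {C : ℝ} (hC : 0 ≤ C)
    (h : ∀ v : n → 𝕜, ∑ i, ‖(M *ᵥ v) i‖ ^ 2 ≤ C ^ 2 * ∑ i, ‖v i‖ ^ 2) : ‖M‖ ≤ C := by
  rw [cstar_norm_def]
  refine ContinuousLinearMap.opNorm_le_bound _ hC fun v => ?_
  refine le_of_sq_le_sq ?_ (by positivity)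
  rw [mul_pow, EuclideanSpace.norm_sq_eq, EuclideanSpace.norm_sq_eq, ofLp_toEuclideanCLM]
  exact h _

lemma l2_opNorm_map_ofReal_le (M : Matrix n n ℝ) : ‖M.map ((↑) : ℝ → ℂ)‖ ≤ ‖M‖ := by
  refine l2_opNorm_le_of_sum_norm_sq _ (norm_nonneg _) fun v => ?_
  have hsplit : ∀ w : n → ℂ, ∑ i, ‖w i‖ ^ 2 =
      ∑ i, ‖(w i).re‖ ^ 2 + ∑ i, ‖(w i).im‖ ^ 2 := fun w => by
    rw [← Finset.sum_add_distrib]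
    refine Finset.sum_congr rfl fun i _ => ?_
    rw [Complex.sq_norm, Complex.normSq_apply, Real.norm_eq_abs, Real.norm_eq_abs, sq_abs, sq_abs]
    ring
  have hre : ∀ i, ((M.map ((↑) : ℝ → ℂ) *ᵥ v) i).re = (M *ᵥ fun j => (v j).re) i := fun i => by
    simp [mulVec, dotProduct]
  have him : ∀ i, ((M.map ((↑) : ℝ → ℂ) *ᵥ v) i).im = (M *ᵥ fun j => (v j).im) i := fun i => by
    simp [mulVec, dotProduct]
  rw [hsplit, hsplit v, mul_add]
  simp only [hre, him]
  exact add_le_add (sum_norm_sq_mulVec_le M _) (sum_norm_sq_mulVec_le M _)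

lemma l2_opNorm_map_star_le (M : Matrix n n ℂ) : ‖M.map star‖ ≤ ‖M‖ := by
  refine l2_opNorm_le_of_sum_norm_sq _ (norm_nonneg _) fun v => ?_
  have h := sum_norm_sq_mulVec_le M (fun i => star (v i))
  have e : ∀ i, (M.map star *ᵥ v) i = star ((M *ᵥ fun j => star (v j)) i) := fun i => by
    simp [mulVec, dotProduct]
  simpa only [e, norm_star] using h

lemma sum_norm_sq_col_le (M : Matrix n n ℂ) (i : n) : ∑ j, ‖M j i‖ ^ 2 ≤ ‖M‖ ^ 2 := by
  have h := sum_norm_sq_mulVec_le M (Pi.single i 1)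
  have e : ∑ j, ‖(Pi.single i 1 : n → ℂ) j‖ ^ 2 = 1 := by
    rw [Finset.sum_eq_single i]
    · simp
    · intro j _ hj; simp [hj]
    · simp
  rw [e, mul_one] at h
  simpa using h

/-- An orthogonal matrix close to the identity has a small real antisymmetric logarithm. -/
lemma exists_antisymm_log {R : Matrix n n ℝ} (hR : Rᵀ * R = 1) (hR1 : ‖R - 1‖ < 1) :
    ∃ B : Matrix n n ℝ, Bᵀ = -B ∧ NormedSpace.exp B = R ∧
      ∀ i, √(∑ j, B i j ^ 2) ≤ 2 * ‖R - 1‖ := by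
  let φ : Matrix n n ℝ →+* Matrix n n ℂ := Complex.ofRealHom.mapMatrix
  have hφ : ∀ M, φ M = M.map ((↑) : ℝ → ℂ) := fun M => rfl
  have hφstar : ∀ M, star (φ M) = φ Mᵀ := fun M => by
    ext i j; simp [hφ, star_apply]
  have hR' : R * Rᵀ = 1 := mul_eq_one_comm.1 hR
  let u : unitary (Matrix n n ℂ) := ⟨φ R, Unitary.mem_iff.2
    ⟨by rw [hφstar, ← map_mul, hR, map_one], by rw [hφstar, ← map_mul, hR', map_one]⟩⟩
  have hle : ‖(u - 1 : Matrix n n ℂ)‖ ≤ ‖R - 1‖ := by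
    have : (u - 1 : Matrix n n ℂ) = φ (R - 1) := by rw [map_sub, map_one]
    rw [this]
    exact l2_opNorm_map_ofReal_le _
  have hu2 : ‖(u - 1 : Matrix n n ℂ)‖ < 2 := by linarith
  set H := Unitary.argSelfAdjoint u with hH
  have hexp : NormedSpace.exp (Complex.I • (H : Matrix n n ℂ)) = φ R := by
    have := congrArg Subtype.val (expUnitary_argSelfAdjoint hu2)
    rwa [selfAdjoint.expUnitary_coe] at this
  have hnorm : ‖(H : Matrix n n ℂ)‖ ≤ 2 * ‖R - 1‖ := by
    have h1 := Unitary.two_mul_one_sub_cos_norm_argSelfAdjoint hu2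
    have h2 := Unitary.norm_argSelfAdjoint_le_pi u
    rw [← hH] at h1 h2
    have h0 : 0 ≤ ‖H‖ := norm_nonneg _
    have h3 := Real.cos_le_one_sub_mul_cos_sq (x := ‖H‖) (by rwa [abs_of_nonneg h0])
    have hpi : Real.pi ^ 2 ≤ 16 := by
      nlinarith [Real.pi_le_four, Real.pi_pos]
    have h4 : 2 / 16 ≤ 2 / Real.pi ^ 2 := by
      have := Real.pi_pos
      gcongr
    have h5 : ‖H‖ ^ 2 ≤ (2 * ‖(u - 1 : Matrix n n ℂ)‖) ^ 2 := by
      have := mul_le_mul_of_nonneg_right h4 (sq_nonneg ‖H‖)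
      nlinarith
    have h6 : ‖H‖ ≤ 2 * ‖(u - 1 : Matrix n n ℂ)‖ := le_of_sq_le_sq h5 (by positivity)
    change ‖H‖ ≤ _
    linarith
  have hsa : ∀ i j, star ((H : Matrix n n ℂ) i j) = (H : Matrix n n ℂ) j i := fun i j => by
    have := congrFun (congrFun H.2.star_eq j) i
    simpa [star_apply] using this
  have hstar : (H : Matrix n n ℂ).map star = (H : Matrix n n ℂ)ᵀ := by
    ext i j; simpa using hsa i j
  -- By uniqueness of the principal logarithm, `H` is purely imaginary.
  have hconj : (H : Matrix n n ℂ)ᵀ = -H := by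
    -- As H is Hermitian, -Hᵀ is minus its entrywise conjugate; it is another logarithm of u because
    -- u has real entries. Both have norm below 2 < π, where the logarithm is unique.
    let H' : selfAdjoint (Matrix n n ℂ) := ⟨-(H : Matrix n n ℂ)ᵀ, by
      rw [selfAdjoint.mem_iff, star_neg]
      exact congrArg Neg.neg hstar⟩
    have hlt : ‖H'‖ < Real.pi := by
      have : ‖(H : Matrix n n ℂ)ᵀ‖ ≤ ‖(H : Matrix n n ℂ)‖ := hstar ▸ l2_opNorm_map_star_le _
      change ‖-(H : Matrix n n ℂ)ᵀ‖ < _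
      rw [norm_neg]
      linarith [Real.pi_gt_three]
    have hE : selfAdjoint.expUnitary H' = u := by
      apply Subtype.ext
      rw [selfAdjoint.expUnitary_coe]
      change NormedSpace.exp (Complex.I • -(H : Matrix n n ℂ)ᵀ) = φ R
      rw [smul_neg, ← transpose_smul, ← transpose_neg, exp_transpose, Matrix.exp_neg, hexp]
      have h1 : (φ R)⁻¹ = φ Rᵀ := Matrix.inv_eq_left_inv (by rw [← map_mul, hR, map_one])
      rw [h1]
      rfl
    have h1 := argSelfAdjoint_expUnitary hlt
    rw [hE] at h1
    have h2 := congrArg Subtype.val h1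
    change (H : Matrix n n ℂ) = -(H : Matrix n n ℂ)ᵀ at h2
    rw [eq_neg_iff_add_eq_zero] at h2
    rw [eq_neg_iff_add_eq_zero, add_comm, h2]
  have hre : ∀ i j, ((H : Matrix n n ℂ) i j).re = 0 := fun i j => by
    have h1 := congrArg Complex.re (hsa i j)
    have h2 := congrArg Complex.re (congrFun (congrFun hconj i) j)
    simp at h1 h2
    linarith
  -- H is i times its imaginary part, so iH = -Im H is real.
  let B : Matrix n n ℝ := Matrix.of fun i j => -((H : Matrix n n ℂ) i j).im
  have hB : φ B = Complex.I • (H : Matrix n n ℂ) := by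
    ext i j
    apply Complex.ext
    · simp [hφ, B]
    · simp [hφ, B, hre]
  refine ⟨B, ?_, ?_, fun i => ?_⟩
  · ext i j
    have h1 := congrArg Complex.im (hsa i j)
    simp at h1
    simp [B, ← h1]
  · have hinj : Function.Injective φ := fun M N h =>
      Matrix.map_injective Complex.ofReal_injective h
    apply hinj
    rw [← hexp, ← hB]
    have hc : Continuous φ := by
      change Continuous fun M : Matrix n n ℝ => M.map ((↑) : ℝ → ℂ)
      exact continuous_id.matrix_map Complex.continuous_ofReal
    let _ : NormedAlgebra ℚ (Matrix n n ℝ) := NormedAlgebra.restrictScalars ℚ ℝ _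
    let _ : NormedAlgebra ℚ (Matrix n n ℂ) := NormedAlgebra.restrictScalars ℚ ℂ _
    exact NormedSpace.map_exp φ hc B
  · refine Real.sqrt_le_iff.2 ⟨by positivity, ?_⟩
    -- Column i of H has the same moduli as row i, H being Hermitian, hence as row i of B.
    have h1 := sum_norm_sq_col_le (H : Matrix n n ℂ) i
    refine le_trans (Finset.sum_le_sum fun j _ => ?_)
      (h1.trans (pow_le_pow_left₀ (norm_nonneg _) hnorm 2))
    rw [← hsa i j, norm_star, Complex.sq_norm, Complex.normSq_apply, hre]
    simp only [B, Matrix.of_apply]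
    nlinarith

end RealLogarithm

/-! ### Active transformations and the final estimate. -/

lemma IsActiveFLO.mem_unitary {d : ℕ} {O : Matrix.specialOrthogonalGroup (Fin (2 * d)) ℝ}
    {V : FockOp d} (hV : IsActiveFLO O V) : V ∈ unitary (FockOp d) := by
  obtain ⟨A, hA, -, rfl⟩ := hV
  exact gaussianOp_mem_unitary hA

lemma IsActiveFLO.majoranaVec_mul {d : ℕ} {O : Matrix.specialOrthogonalGroup (Fin (2 * d)) ℝ}
    {V : FockOp d} (hV : IsActiveFLO O V) (v : Fin (2 * d) → ℝ) :
    majoranaVec ((O : Matrix (Fin (2 * d)) (Fin (2 * d)) ℝ) *ᵥ v) * V = V * majoranaVec v := by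
  obtain ⟨A, hA, hO, rfl⟩ := hV
  rw [← hO]
  exact majoranaVec_mul_gaussianOp hA v

end FLO
end

open scoped Matrix.Norms.L2Operator in
theorem lemma8 (d : ℕ) (O O' : Matrix.specialOrthogonalGroup (Fin (2 * d)) ℝ)
    (V V' : FLO.FockOp d) (hV : FLO.IsActiveFLO O V) (hV' : FLO.IsActiveFLO O' V') :
    FLO.diamondNorm (FLO.unitaryChannel V - FLO.unitaryChannel V') ≤
      ENNReal.ofReal (2 * (d : ℝ) *
        FLO.opNorm ((O : Matrix (Fin (2 * d)) (Fin (2 * d)) ℝ) -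
          (O' : Matrix (Fin (2 * d)) (Fin (2 * d)) ℝ))) := by
  have hO := (Matrix.mem_specialOrthogonalGroup_iff.1 O.2).1
  have hO' := (Matrix.mem_specialOrthogonalGroup_iff.1 O'.2).1
  have hact := hV.majoranaVec_mul
  have hact' := hV'.majoranaVec_mul
  have hU := hV.mem_unitary
  have hU' := hV'.mem_unitary
  generalize (O : Matrix (Fin (2 * d)) (Fin (2 * d)) ℝ) = P at *
  generalize (O' : Matrix (Fin (2 * d)) (Fin (2 * d)) ℝ) = P' at *
  change _ ≤ ENNReal.ofReal (2 * (d : ℝ) * ‖P - P'‖)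
  have hP'1 : star P' * P' = 1 := (Unitary.mem_iff.1 hO').1
  have hP'2 : P' * star P' = 1 := (Unitary.mem_iff.1 hO').2
  have hnorm : ‖P - P'‖ = ‖star P' * P - 1‖ := by
    rw [← CStarRing.norm_mem_unitary_mul (P - P') (Unitary.star_mem hO'), mul_sub, hP'1]
  rw [hnorm]
  set R := star P' * P with hR
  have hPR : P = P' * R := by rw [hR, ← mul_assoc, hP'2, one_mul]
  have hRR : R.transpose * R = 1 :=
    (Unitary.mem_iff.1 (mul_mem (Unitary.star_mem hO') hO)).1
  by_cases hR1 : ‖R - 1‖ < 1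
  · obtain ⟨B, hB, hexp, hrow⟩ := FLO.exists_antisymm_log hRR hR1
    -- V'G acts on Majorana operators by P'R = P, exactly as V does.
    obtain ⟨c, hc, hcV⟩ := FLO.exists_phase_of_same_action hU
      (mul_mem hU' (FLO.gaussianOp_mem_unitary hB)) P hact (fun v => by
        rw [hPR, ← Matrix.mulVec_mulVec, ← mul_assoc, hact', mul_assoc, ← hexp,
          FLO.majoranaVec_mul_gaussianOp hB, mul_assoc])
    rw [hcV, FLO.unitaryChannel_smul _ hc]
    refine (FLO.diamondNorm_mul_sub_le (FLO.gaussianOp_mem_unitary hB) hU').trans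
      (ENNReal.ofReal_le_ofReal ?_)
    -- Constants: 1/4 · 2d rows · 2‖R - 1‖ = d‖R - 1‖, doubled by the channel estimate.
    have h1 := FLO.norm_gaussianOp_sub_one_le hB
    have h2 := Finset.sum_le_sum fun i (_ : i ∈ Finset.univ) => hrow i
    rw [Finset.sum_const, Finset.card_univ, Fintype.card_fin, nsmul_eq_mul] at h2
    push_cast at h2
    linarith
  · refine (FLO.diamondNorm_sub_le_two hU hU').trans (ENNReal.ofReal_le_ofReal ?_)
    -- For d = 0 the matrices are empty and ‖R - 1‖ = 0, which belongs to the other case. Hence d ≥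
    -- 1 and 2 ≤ 2d‖R - 1‖.
    have hd : (1 : ℝ) ≤ d := by
      rcases Nat.eq_zero_or_pos d with rfl | hd
      · exact absurd (by
          have : R - 1 = 0 := Matrix.ext fun i => Fin.elim0 i
          rw [this, norm_zero]; exact one_pos) hR1
      · exact_mod_cast hd
    nlinarith
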